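/- Let $\mathcal H=\ell^2(\mathbb N)$ be the Hilbert space of one bosonic mode, with Fock basis $|0\rangle,|1\rangle,\dots$ A state is a positive operator on $\mathcal H$ of trace one. For $\alpha\in\mathbb C$ let $|\alpha\rangle=e^{-|\alpha|^2/2}\sum_{k\ge 0}\frac{\alpha^k}{\sqrt{k!}}|k\rangle$ be the coherent state. A state $\sigma$ is classical if it is a convex mixture of coherent states, i.e. $\sigma=\int_{\mathbb C}|\alpha\rangle\langle\alpha|\,d\varphi(\alpha)$ for some probability measure $\varphi$ on $\mathbb C$, and nonclassical otherwise. A channel is nonclassicality-breaking if its output is classical for every input state. Write $Q(\alpha;\sigma)=\langle\alpha|\sigma|\alpha\rangle$. For $\kappa\ge 0$ the two-mode (system, environment) phase-conjugation unitary $U$ has the Fock matrix elements $$\langle m_1,m_2|U|n_1,n_2\rangle=\frac{1}{\sqrt{1+\kappa^2}}\sqrt{\frac{n_2!\,m_2!}{m_1!\,n_1!}}\sum_{r=0}^{m_1}\sum_{j=0}^{n_1}\binom{m_1}{r}\binom{n_1}{j}(-1)^j\Big(\frac{1}{\sqrt{1+\kappa^2}}\Big)^{n_1-j+r}\Big(\frac{\kappa}{\sqrt{1+\kappa^2}}\Big)^{m_1-r+j}\delta_{n_2,\,r+j}\,\delta_{m_2,\,n_1+m_1-r-j}.$$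 For $n\in\mathbb N=\{0,1,2,\dots\}$, the $n$-photon-added phase-conjugation channel is $$\mathcal C(\kappa;n)[\rho]=\mathrm{Tr}_E\big[U(\rho\otimes|n\rangle\langle n|)U^\dagger\big]=\sum_{\ell=0}^\infty C_\ell\,\rho\,C_\ell^\dagger,\qquad C_\ell=\sum_{m,k\ge 0,\;m+k=n+\ell}\langle m,\ell|U|k,n\rangle\,|m\rangle\langle k|.$$ Proposition. For all real $\kappa\ge 0$ and all integers $n\ge 0$, the channel $\mathcal C(\kappa;n)$ is nonclassicality-breaking if and only if $n=0$. Moreover, for every $n>0$, the output $\sigma=\mathcal C(\kappa;n)[|0\rangle\langle 0|]$ on the vacuum input satisfies $\langle\tau|\sigma|\tau\rangle=0$ for all $\tau=0,1,\dots,n-1$, one has $Q(0;\sigma)=0$, and $\sigma$ is a nonclassical state. -/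

import Mathlib

noncomputable section

namespace PhotonAdded

open scoped InnerProductSpace

/-- The Hilbert space of a single bosonic mode, in its Fock (number state) representation:
square-summable complex sequences. -/
abbrev Mode : Type := lp (fun _ : ℕ => ℂ) 2

/-- The Fock state `|n⟩`. -/
def fock (n : ℕ) : Mode := lp.single 2 n (1 : ℂ)

/-- The operator `|x⟩⟨y|`. -/
abbrev ketBra (x y : Mode) : Mode →L[ℂ] Mode := InnerProductSpace.rankOne ℂ x y

theorem memℓp_coherent (α : ℂ) :
    Memℓp (fun k : ℕ =>
      ((Real.exp (-‖α‖ ^ 2 / 2) : ℝ) : ℂ) * α ^ k / ((Real.sqrt (k.factorial : ℝ) : ℝ) : ℂ)) 2 := by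
  rw [memℓp_gen_iff (by norm_num)]
  have h := (Real.summable_pow_div_factorial (‖α‖ ^ 2)).mul_left (Real.exp (-‖α‖ ^ 2 / 2) ^ 2)
  refine h.congr fun k => ?_
  have hk : (0 : ℝ) ≤ (k.factorial : ℝ) := by positivity
  simp only [norm_div, norm_mul, norm_pow, Complex.norm_real, Real.norm_eq_abs,
    ENNReal.toReal_ofNat, Real.rpow_two, Real.abs_exp, abs_of_nonneg (Real.sqrt_nonneg _)]
  rw [div_pow, mul_pow, Real.sq_sqrt hk]
  ring

/-- The coherent state `|α⟩ = exp(-|α|²/2) ∑ₖ αᵏ/√k! |k⟩`. -/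
def coherent (α : ℂ) : Mode :=
  ⟨fun k : ℕ =>
    ((Real.exp (-‖α‖ ^ 2 / 2) : ℝ) : ℂ) * α ^ k / ((Real.sqrt (k.factorial : ℝ) : ℝ) : ℂ),
    memℓp_coherent α⟩

/-- Density operators: positive operators of trace one. -/
def IsState (ρ : Mode →L[ℂ] Mode) : Prop :=
  ρ.IsPositive ∧ HasSum (fun k : ℕ => ⟪fock k, ρ (fock k)⟫_ℂ) 1

/-- Classical states: convex mixtures of coherent states, that is, operators with a nonnegative
(normalised) Glauber-Sudarshan weight. The weight is a measure, since it may be singular: the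
weight of a coherent state is a point mass. -/
def IsClassical (σ : Mode →L[ℂ] Mode) : Prop :=
  ∃ φ : MeasureTheory.Measure ℂ, MeasureTheory.IsProbabilityMeasure φ ∧
    σ = ∫ α, ketBra (coherent α) (coherent α) ∂φ

/-- Nonclassical states: density operators that are not classical. -/
def IsNonclassical (σ : Mode →L[ℂ] Mode) : Prop :=
  IsState σ ∧ ¬ IsClassical σ

/-- A map of states is nonclassicality breaking if every input state has a classical output. -/
def IsNonclassicalityBreaking (Φ : (Mode →L[ℂ] Mode) → (Mode →L[ℂ] Mode)) : Prop :=
  ∀ ρ, IsState ρ → IsClassical (Φ ρ)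

/-- The Husimi function `Q(α; σ) = ⟨α|σ|α⟩`. -/
def husimiQ (σ : Mode →L[ℂ] Mode) (α : ℂ) : ℂ :=
  ⟪coherent α, σ (coherent α)⟫_ℂ

/-- The Fock matrix elements `⟨m₁,m₂|U|n₁,n₂⟩` (first mode the system, second mode the environment)
of the two-mode phase conjugation unitary `U` with parameter `κ ≥ 0`. The factor
`(√(1 + κ⁻²))⁻¹` is written as `κ / √(1 + κ²)`, which also covers `κ = 0`. -/
def pcMatrix (κ : ℝ) (m₁ m₂ n₁ n₂ : ℕ) : ℝ :=
  (Real.sqrt (1 + κ ^ 2))⁻¹ *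
    Real.sqrt ((n₂.factorial * m₂.factorial : ℝ) / (m₁.factorial * n₁.factorial : ℝ)) *
    ∑ r ∈ Finset.range (m₁ + 1), ∑ j ∈ Finset.range (n₁ + 1),
      if n₂ = r + j ∧ m₂ + (r + j) = n₁ + m₁ then
        (m₁.choose r : ℝ) * (n₁.choose j : ℝ) * (-1) ^ j *
          (Real.sqrt (1 + κ ^ 2))⁻¹ ^ (n₁ - j + r) *
          (κ / Real.sqrt (1 + κ ^ 2)) ^ (m₁ - r + j)
      else 0

theorem pcMatrix_eq_zero (κ : ℝ) {m₁ m₂ n₁ n₂ : ℕ} (h : m₁ + n₁ ≠ n₂ + m₂) :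
    pcMatrix κ m₁ m₂ n₁ n₂ = 0 := by
  unfold pcMatrix
  rw [Finset.sum_eq_zero, mul_zero]
  intro r _
  refine Finset.sum_eq_zero fun j _ => if_neg ?_
  omega

/-- The operator `⟨ℓ|U|n⟩` on the system mode, `|n⟩` being the initial state of the environment and
`|ℓ⟩` the Fock state in the partial trace over the environment: the sum of
`⟨m,ℓ|U|k,n⟩ |m⟩⟨k|` over all `m`, `k`, where only the terms with `m + k = n + ℓ` are nonzero. -/
def pcKraus (κ : ℝ) (n ℓ : ℕ) : Mode →L[ℂ] Mode :=
  ∑ p ∈ Finset.HasAntidiagonal.antidiagonal (n + ℓ),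
    ((pcMatrix κ p.1 ℓ p.2 n : ℝ) : ℂ) • ketBra (fock p.1) (fock p.2)

theorem inner_fock_fock (m k : ℕ) : ⟪fock m, fock k⟫_ℂ = if m = k then 1 else 0 := by
  unfold fock
  rw [lp.inner_single_left, lp.single_apply, Pi.single_apply]
  split_ifs <;> simp

/-- The Fock matrix elements of `⟨ℓ|U|n⟩` are those of `U`. -/
theorem inner_pcKraus (κ : ℝ) (n ℓ m k : ℕ) :
    ⟪fock m, pcKraus κ n ℓ (fock k)⟫_ℂ = ((pcMatrix κ m ℓ k n : ℝ) : ℂ) := by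
  have key : ∀ p ∈ Finset.HasAntidiagonal.antidiagonal (n + ℓ),
      ⟪fock m, (((pcMatrix κ p.1 ℓ p.2 n : ℝ) : ℂ) • ketBra (fock p.1) (fock p.2)) (fock k)⟫_ℂ =
        if p = (m, k) then ((pcMatrix κ m ℓ k n : ℝ) : ℂ) else 0 := by
    rintro ⟨a, b⟩ -
    rw [smul_apply, InnerProductSpace.rankOne_apply, inner_smul_right,
      inner_smul_right, inner_fock_fock, inner_fock_fock]
    rcases eq_or_ne a m with rfl | ha
    · rcases eq_or_ne b k with rfl | hb
      · simp
      · simp [hb]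
    · simp [ha, ha.symm]
  unfold pcKraus
  rw [sum_apply, inner_sum, Finset.sum_congr rfl key, Finset.sum_ite_eq']
  split_ifs with h
  · rfl
  · rw [Finset.HasAntidiagonal.mem_antidiagonal] at h
    rw [pcMatrix_eq_zero κ h, Complex.ofReal_zero]

/-- The photon-added phase conjugation channel
`𝒞(κ;n)[ρ] = Tr_E (U (ρ ⊗ |n⟩⟨n|) U†) = ∑_ℓ ⟨ℓ|U|n⟩ ρ ⟨ℓ|U|n⟩†`. -/
def phaseConj (κ : ℝ) (n : ℕ) (ρ : Mode →L[ℂ] Mode) : Mode →L[ℂ] Mode :=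
  ∑' ℓ : ℕ, pcKraus κ n ℓ ∘L ρ ∘L ContinuousLinearMap.adjoint (pcKraus κ n ℓ)

end PhotonAdded

end

namespace PhotonAdded

open MeasureTheory Filter Topology
open scoped InnerProductSpace ComplexConjugate

/-! ### Fock-basis coordinates of vectors and operators -/

section Fock

/-! Put `c = 1/√(1+κ²)` and `s = κ/√(1+κ²)`, so that `c² + s² = 1`.

For `n > 0`, `U` conserves a photon count, so the vacuum input gives a mixture of the states
`|n+ℓ⟩`, with negative binomial weights (`hasSum_phaseConj_vacuum`). This mixture has no overlap
with `|0⟩`. A classical state has overlap `∫ exp(-|α|²) dφ > 0` with `|0⟩`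
(`IsClassical.inner_fock_zero_ne_zero`), so the output is nonclassical.

For `n = 0` and `κ > 0` the channel measures and prepares: its output is `∫ |sz⟩⟨sz| (c²/π) Q(c z̄;
ρ) dz`, an explicit nonnegative mixture. This is checked on Fock matrix elements. Expanding `Q` in
the Fock basis leaves the moments `∫ zᵃ z̄ᵇ exp(-|z|²) = π a! δ_ab`, which reproduce the products of
two entries of `U` (`hasSum_integral_outputDensity`). Since `c < 1`, geometric decay allows sum and
integral to be exchanged. The weight has mass one because the channel preserves the trace
(`lintegral_outputDensity`). At `κ = 0` every output is the vacuum. -/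

theorem inner_fock_left (m : ℕ) (x : Mode) : ⟪fock m, x⟫_ℂ = x m := by
  unfold fock
  rw [lp.inner_single_left]
  simp

theorem norm_fock (m : ℕ) : ‖fock m‖ = 1 := by
  rw [← sq_eq_sq₀ (norm_nonneg _) zero_le_one, ← Complex.ofReal_inj]
  have := inner_self_eq_norm_sq_to_K (𝕜 := ℂ) (fock m)
  rw [inner_fock_fock] at this
  simpa using this.symm

theorem hasSum_smul_fock (x : Mode) : HasSum (fun k => x k • fock k) x := by
  have h := lp.hasSum_single ENNReal.ofNat_ne_top x
  refine h.congr_fun ?_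
  intro k
  rw [fock, ← lp.single_smul]
  simp

theorem ext_fock {A B : Mode →L[ℂ] Mode}
    (h : ∀ m k, ⟪fock m, A (fock k)⟫_ℂ = ⟪fock m, B (fock k)⟫_ℂ) : A = B := by
  have hk : ∀ k, A (fock k) = B (fock k) := by
    intro k
    ext m
    rw [← inner_fock_left, ← inner_fock_left, h]
  ext1 x
  have hx := hasSum_smul_fock x
  have hA := A.hasSum hx
  have hB := B.hasSum hx
  simp only [map_smul, hk] at hA hB
  exact hA.unique hB

/-- The matrix element `⟨x|A|y⟩` as a continuous linear functional of the operator `A`. -/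
noncomputable def matrixElement (x y : Mode) : (Mode →L[ℂ] Mode) →L[ℂ] ℂ :=
  (innerSL ℂ x) ∘L (ContinuousLinearMap.apply ℂ Mode y)

theorem matrixElement_apply (x y : Mode) (A : Mode →L[ℂ] Mode) :
    matrixElement x y A = ⟪x, A y⟫_ℂ := rfl

theorem inner_ketBra (x y u v : Mode) : ⟪x, ketBra u v y⟫_ℂ = ⟪x, u⟫_ℂ * ⟪v, y⟫_ℂ := by
  rw [InnerProductSpace.rankOne_apply, inner_smul_right, mul_comm]

end Fock

/-! ### Coherent states and their mixtures -/

section Coherent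

theorem coherent_apply (α : ℂ) (k : ℕ) :
    coherent α k = ((Real.exp (-‖α‖ ^ 2 / 2) : ℝ) : ℂ) * α ^ k /
      ((Real.sqrt (k.factorial : ℝ) : ℝ) : ℂ) := rfl

theorem ofReal_sqrt_mul_self {x : ℝ} (hx : 0 ≤ x) :
    ((Real.sqrt x : ℝ) : ℂ) * ((Real.sqrt x : ℝ) : ℂ) = x := by
  rw [← Complex.ofReal_mul, Real.mul_self_sqrt hx]

theorem inner_coherent (α β : ℂ) :
    ⟪coherent α, coherent β⟫_ℂ =
      ((Real.exp (-‖α‖ ^ 2 / 2) : ℝ) : ℂ) * ((Real.exp (-‖β‖ ^ 2 / 2) : ℝ) : ℂ) *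
        Complex.exp (conj α * β) := by
  refine (lp.hasSum_inner (coherent α) (coherent β)).unique ?_
  have h : HasSum (fun n : ℕ => (conj α * β) ^ n / (n.factorial : ℂ)) (Complex.exp (conj α * β)) := by
    rw [Complex.exp_eq_exp_ℂ]
    exact NormedSpace.expSeries_div_hasSum_exp _
  refine (h.mul_left _).congr_fun fun n => ?_
  rw [coherent_apply, coherent_apply, RCLike.inner_apply]
  simp only [map_div₀, map_mul, map_pow, Complex.conj_ofReal]
  have hn := ofReal_sqrt_mul_self (Nat.cast_nonneg (α := ℝ) n.factorial)
  rw [Complex.ofReal_natCast] at hn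
  rw [← hn, mul_pow, div_mul_div_comm, mul_div_assoc']
  ring

theorem norm_coherent (α : ℂ) : ‖coherent α‖ = 1 := by
  rw [← sq_eq_sq₀ (norm_nonneg _) zero_le_one, ← Complex.ofReal_inj]
  have := inner_self_eq_norm_sq_to_K (𝕜 := ℂ) (coherent α)
  push_cast
  refine this.symm.trans ?_
  rw [inner_coherent, Complex.conj_mul', one_pow, ← Complex.ofReal_mul, ← Complex.ofReal_pow,
    ← Complex.ofReal_exp, ← Complex.ofReal_mul, ← Real.exp_add, ← Real.exp_add]
  rw [show -‖α‖ ^ 2 / 2 + -‖α‖ ^ 2 / 2 + ‖α‖ ^ 2 = 0 by ring]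
  simp

/-- For unit vectors `‖x - y‖² = 2 - 2 Re⟪x, y⟫`, so continuity is read off from the explicit
overlap. -/
theorem continuous_coherent : Continuous coherent := by
  rw [continuous_iff_continuousAt]
  intro β
  rw [ContinuousAt, tendsto_iff_norm_sub_tendsto_zero]
  have key : ∀ α, ‖coherent α - coherent β‖ =
      Real.sqrt (2 - 2 * (⟪coherent α, coherent β⟫_ℂ).re) := by
    intro α
    rw [← Real.sqrt_sq (norm_nonneg (coherent α - coherent β))]
    congr 1
    have := norm_sub_sq (𝕜 := ℂ) (coherent α) (coherent β)
    rw [norm_coherent, norm_coherent] at this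
    rw [this]
    change 1 ^ 2 - 2 * (⟪coherent α, coherent β⟫_ℂ).re + 1 ^ 2 = _
    ring
  have hc : Continuous fun α : ℂ => Real.sqrt (2 - 2 * (⟪coherent α, coherent β⟫_ℂ).re) := by
    simp only [inner_coherent]
    fun_prop
  have h0 := hc.tendsto β
  rw [← key β, sub_self, norm_zero] at h0
  exact h0.congr fun α => (key α).symm

theorem coherent_zero : coherent 0 = fock 0 := by
  ext k
  rw [← inner_fock_left k (fock 0), inner_fock_fock, coherent_apply]
  rcases Nat.eq_zero_or_pos k with rfl | hk
  · simp
  · simp [hk.ne']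

theorem continuous_ketBra_coherent : Continuous fun α => ketBra (coherent α) (coherent α) := by
  have h2 := (ContinuousLinearMap.smulRightL ℂ Mode Mode).continuous₂
  exact h2.comp (((innerSL ℂ (E := Mode)).continuous.comp continuous_coherent).prodMk
    continuous_coherent)

/-- Guarantees that the operator-valued integral in `IsClassical` is never the default value zero,
and lets matrix elements pass under it. -/
theorem integrable_ketBra_coherent (φ : Measure ℂ) [IsFiniteMeasure φ] :
    Integrable (fun α => ketBra (coherent α) (coherent α)) φ := by
  refine Integrable.of_bound continuous_ketBra_coherent.aestronglyMeasurable 1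
    (Eventually.of_forall fun α => ?_)
  simp [norm_coherent]

/-- The matrix elements of a mixture of coherent states. -/
theorem inner_integral_ketBra_coherent (φ : Measure ℂ) [IsFiniteMeasure φ] (x y : Mode) :
    ⟪x, (∫ α, ketBra (coherent α) (coherent α) ∂φ) y⟫_ℂ =
      ∫ α, ⟪x, coherent α⟫_ℂ * ⟪coherent α, y⟫_ℂ ∂φ := by
  rw [← matrixElement_apply, ← ContinuousLinearMap.integral_comp_comm _
    (integrable_ketBra_coherent φ)]
  simp only [matrixElement_apply, inner_ketBra]

theorem isClassical_ketBra_coherent (α : ℂ) : IsClassical (ketBra (coherent α) (coherent α)) :=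
  ⟨Measure.dirac α, inferInstance, by rw [integral_dirac]⟩

/-- A classical operator has nonzero overlap with the vacuum. -/
theorem IsClassical.inner_fock_zero_ne_zero {σ : Mode →L[ℂ] Mode} (h : IsClassical σ) :
    ⟪fock 0, σ (fock 0)⟫_ℂ ≠ 0 := by
  obtain ⟨φ, hφ, rfl⟩ := h
  rw [inner_integral_ketBra_coherent]
  have h1 : ∀ α, ⟪fock 0, coherent α⟫_ℂ * ⟪coherent α, fock 0⟫_ℂ =
      ((Real.exp (-‖α‖ ^ 2) : ℝ) : ℂ) := by
    intro α
    rw [← coherent_zero, inner_coherent, inner_coherent]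
    simp only [norm_zero, map_zero, mul_zero, zero_mul, Complex.exp_zero, mul_one]
    rw [← Complex.ofReal_mul, ← Complex.ofReal_mul, ← Complex.ofReal_mul, ← Real.exp_add,
      ← Real.exp_add, ← Real.exp_add]
    congr 2
    ring
  simp only [h1]
  rw [integral_complex_ofReal, Complex.ofReal_ne_zero]
  refine (integral_pos_iff_support_of_nonneg (fun α => (Real.exp_pos _).le) ?_).2 ?_ |>.ne'
  · refine Integrable.of_bound (by fun_prop) 1 (Eventually.of_forall fun α => ?_)
    rw [Real.norm_eq_abs, Real.abs_exp, Real.exp_le_one_iff]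
    nlinarith [sq_nonneg ‖α‖]
  · have : Function.support (fun α : ℂ => Real.exp (-‖α‖ ^ 2)) = Set.univ := by
      ext α
      simp [(Real.exp_pos _).ne']
    rw [this, measure_univ]
    exact one_pos

end Coherent

/-! ### Gaussian moments on the complex plane -/

section GaussianMoments

theorem integral_norm_pow_mul_exp_neg_sq (a : ℕ) :
    ∫ z : ℂ, ‖z‖ ^ (2 * a) * Real.exp (-‖z‖ ^ 2) = Real.pi * a.factorial := by
  have h := Complex.integral_rpow_mul_exp_neg_rpow (p := 2) (q := ((2 * a : ℕ) : ℝ)) one_le_two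
    (by have : (0 : ℝ) ≤ ((2 * a : ℕ) : ℝ) := Nat.cast_nonneg _
        linarith)
  simp only [Real.rpow_natCast, Real.rpow_two] at h
  rw [h, show (((2 * a : ℕ) : ℝ) + 2) / 2 = (a : ℝ) + 1 by push_cast; ring, Real.Gamma_nat_eq_factorial]
  ring

/-- A non-integrable function would have integral zero by convention, but the moment is positive. -/
theorem integrable_norm_pow_mul_exp_neg_sq (a : ℕ) :
    Integrable fun z : ℂ => ‖z‖ ^ (2 * a) * Real.exp (-‖z‖ ^ 2) := by
  by_contra h
  have h1 := integral_norm_pow_mul_exp_neg_sq a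
  rw [integral_undef h] at h1
  have : 0 < Real.pi * (a.factorial : ℝ) := by positivity
  linarith

theorem integrable_pow_mul_conj_pow_mul_exp_neg_sq (a b : ℕ) :
    Integrable fun z : ℂ => z ^ a * conj z ^ b * ((Real.exp (-‖z‖ ^ 2) : ℝ) : ℂ) := by
  refine ((integrable_norm_pow_mul_exp_neg_sq 0).add
    (integrable_norm_pow_mul_exp_neg_sq (a + b))).mono' ?_ (Eventually.of_forall fun z => ?_)
  · exact Continuous.aestronglyMeasurable (by fun_prop)
  · simp only [norm_mul, norm_pow, RCLike.norm_conj, Complex.norm_real, Real.norm_eq_abs,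
      Real.abs_exp, Pi.add_apply]
    rw [← pow_add, ← add_mul]
    refine mul_le_mul_of_nonneg_right ?_ (Real.exp_pos _).le
    rw [mul_zero, pow_zero, mul_comm 2, pow_mul]
    nlinarith [sq_nonneg (‖z‖ ^ (a + b) - 1)]

/-- The monomials are orthogonal with respect to the Gaussian weight. -/
theorem integral_pow_mul_conj_pow_mul_exp_neg_sq (a b : ℕ) :
    ∫ z : ℂ, z ^ a * conj z ^ b * ((Real.exp (-‖z‖ ^ 2) : ℝ) : ℂ) =
      if a = b then ((Real.pi * a.factorial : ℝ) : ℂ) else 0 := by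
  split_ifs with h
  · subst h
    rw [← integral_norm_pow_mul_exp_neg_sq, ← integral_complex_ofReal]
    congr 1
    ext z
    rw [← mul_pow, Complex.mul_conj']
    push_cast
    rw [← pow_mul]
  · set f : ℂ → ℂ := fun z => z ^ a * conj z ^ b * ((Real.exp (-‖z‖ ^ 2) : ℝ) : ℂ) with hf
    have hab : (a : ℝ) - b ≠ 0 := sub_ne_zero.2 (by exact_mod_cast h)
    -- Rotation by this angle multiplies `zᵃ z̄ᵇ` by `exp(i(a-b)t) = -1`, so the rotation-invariant
    -- integral equals its own negative.
    set t : ℝ := Real.pi / ((a : ℝ) - b) with ht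
    have hrot : ∀ z, f (rotation (Circle.exp t) z) = -f z := by
      intro z
      have hn : ‖((Circle.exp t : Circle) : ℂ) * z‖ = ‖z‖ := by
        rw [norm_mul, Circle.norm_coe, one_mul]
      have hw : ((Circle.exp t : Circle) : ℂ) ^ a * conj ((Circle.exp t : Circle) : ℂ) ^ b = -1 := by
        rw [Circle.coe_exp, ← Complex.exp_conj, ← Complex.exp_nat_mul, ← Complex.exp_nat_mul,
          ← Complex.exp_add, ← Complex.exp_pi_mul_I]
        congr 1
        simp only [map_mul, Complex.conj_ofReal, Complex.conj_I]
        have : (Real.pi : ℂ) = ((a : ℂ) - b) * (t : ℂ) := by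
          rw [ht]
          push_cast
          have : (a : ℂ) - b ≠ 0 := by exact_mod_cast hab
          field_simp
        rw [this]
        ring
      simp only [hf, rotation_apply, hn, map_mul, mul_pow]
      rw [show ∀ w x y v u : ℂ, w * x * (y * v) * u = (w * y) * (x * v * u) by intros; ring, hw]
      ring
    have h1 : ∫ z, f (rotation (Circle.exp t) z) = ∫ z, f z :=
      (rotation (Circle.exp t)).measurePreserving.integral_comp
        (rotation (Circle.exp t)).toHomeomorph.measurableEmbedding f
    simp only [hrot, integral_neg] at h1
    exact self_eq_neg.1 h1.symm

end GaussianMoments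

/-! ### Matrix elements with a vacuum input on one side -/

section MatrixElements

theorem sqrt_one_add_sq_pos (κ : ℝ) : 0 < Real.sqrt (1 + κ ^ 2) :=
  Real.sqrt_pos.2 (by positivity)

theorem inv_sqrt_sq_add_div_sqrt_sq (κ : ℝ) :
    (Real.sqrt (1 + κ ^ 2))⁻¹ ^ 2 + (κ / Real.sqrt (1 + κ ^ 2)) ^ 2 = 1 := by
  have h : (0 : ℝ) < 1 + κ ^ 2 := by positivity
  rw [inv_pow, div_pow, Real.sq_sqrt h.le]
  field_simp

/-- The constraint `n₂ = r + j = 0` leaves only the term `r = j = 0`. -/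
theorem pcMatrix_vacuum_environment (κ : ℝ) (m k : ℕ) :
    pcMatrix κ m (m + k) k 0 =
      (Real.sqrt (1 + κ ^ 2))⁻¹ * Real.sqrt ((m + k).factorial / (m.factorial * k.factorial)) *
        ((Real.sqrt (1 + κ ^ 2))⁻¹ ^ k * (κ / Real.sqrt (1 + κ ^ 2)) ^ m) := by
  unfold pcMatrix
  rw [Finset.sum_eq_single_of_mem 0 (by simp), Finset.sum_eq_single_of_mem 0 (by simp)]
  · rw [if_pos (by omega)]
    simp
  · intro j _ hj
    rw [if_neg (by omega)]
  · intro r _ hr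
    refine Finset.sum_eq_zero fun j _ => ?_
    rw [if_neg (by omega)]

theorem pcMatrix_vacuum_system (κ : ℝ) (n ℓ : ℕ) :
    pcMatrix κ (n + ℓ) ℓ 0 n =
      (Real.sqrt (1 + κ ^ 2))⁻¹ *
        Real.sqrt (n.factorial * ℓ.factorial / (n + ℓ).factorial) *
        ((n + ℓ).choose n * (Real.sqrt (1 + κ ^ 2))⁻¹ ^ n * (κ / Real.sqrt (1 + κ ^ 2)) ^ ℓ) := by
  unfold pcMatrix
  rw [Finset.sum_eq_single_of_mem n (by simp)]
  · simp [add_comm ℓ n]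
  · intro r _ hr
    refine Finset.sum_eq_zero fun j hj => ?_
    simp only [zero_add, Finset.range_one, Finset.mem_singleton] at hj
    rw [if_neg (by omega)]

theorem pcMatrix_vacuum_environment_sq (κ : ℝ) (m k : ℕ) :
    pcMatrix κ m (m + k) k 0 ^ 2 =
      ((Real.sqrt (1 + κ ^ 2))⁻¹ ^ 2) ^ (k + 1) *
        ((m + k).choose k * ((κ / Real.sqrt (1 + κ ^ 2)) ^ 2) ^ m) := by
  rw [pcMatrix_vacuum_environment, mul_pow, mul_pow, mul_pow, Real.sq_sqrt (by positivity),
    Nat.cast_choose ℝ (Nat.le_add_left k m), Nat.add_sub_cancel]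
  ring

theorem pcMatrix_vacuum_system_sq (κ : ℝ) (n ℓ : ℕ) :
    pcMatrix κ (n + ℓ) ℓ 0 n ^ 2 =
      ((Real.sqrt (1 + κ ^ 2))⁻¹ ^ 2) ^ (n + 1) *
        ((ℓ + n).choose n * ((κ / Real.sqrt (1 + κ ^ 2)) ^ 2) ^ ℓ) := by
  rw [pcMatrix_vacuum_system, mul_pow, mul_pow, Real.sq_sqrt (by positivity), add_comm ℓ n,
    Nat.cast_choose ℝ (Nat.le_add_right n ℓ), Nat.add_sub_cancel_left]
  have h1 : ((n + ℓ).factorial : ℝ) ≠ 0 := by positivity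
  have h2 : (n.factorial : ℝ) ≠ 0 := by positivity
  have h3 : (ℓ.factorial : ℝ) ≠ 0 := by positivity
  generalize (Real.sqrt (1 + κ ^ 2))⁻¹ = c
  generalize κ / Real.sqrt (1 + κ ^ 2) = s
  field_simp
  ring

/-- The negative binomial series with success probability `c² = 1 - s²`. It normalises both the
vacuum output for any `n` and the channel with vacuum environment. -/
theorem hasSum_negative_binomial (κ : ℝ) (k : ℕ) :
    HasSum (fun m : ℕ => ((Real.sqrt (1 + κ ^ 2))⁻¹ ^ 2) ^ (k + 1) *
        ((m + k).choose k * ((κ / Real.sqrt (1 + κ ^ 2)) ^ 2) ^ m)) 1 := by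
  have h := inv_sqrt_sq_add_div_sqrt_sq κ
  have hc : 0 < (Real.sqrt (1 + κ ^ 2))⁻¹ ^ 2 := by
    have := sqrt_one_add_sq_pos κ
    positivity
  have hlt : ‖(κ / Real.sqrt (1 + κ ^ 2)) ^ 2‖ < 1 := by
    rw [Real.norm_eq_abs, abs_of_nonneg (sq_nonneg _)]
    linarith
  have hs := (hasSum_choose_mul_geometric_of_norm_lt_one k hlt).mul_left
    (((Real.sqrt (1 + κ ^ 2))⁻¹ ^ 2) ^ (k + 1))
  rwa [← eq_sub_iff_add_eq.2 h, mul_one_div, div_self (pow_pos hc _).ne'] at hs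

theorem hasSum_pcMatrix_vacuum_environment_sq (κ : ℝ) (k : ℕ) :
    HasSum (fun m : ℕ => pcMatrix κ m (m + k) k 0 ^ 2) 1 := by
  simp only [pcMatrix_vacuum_environment_sq]
  exact hasSum_negative_binomial κ k

theorem hasSum_pcMatrix_vacuum_system_sq (κ : ℝ) (n : ℕ) :
    HasSum (fun ℓ : ℕ => pcMatrix κ (n + ℓ) ℓ 0 n ^ 2) 1 := by
  simp only [pcMatrix_vacuum_system_sq]
  exact hasSum_negative_binomial κ n

theorem pcKraus_fock_zero (κ : ℝ) (n ℓ : ℕ) :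
    pcKraus κ n ℓ (fock 0) = ((pcMatrix κ (n + ℓ) ℓ 0 n : ℝ) : ℂ) • fock (n + ℓ) := by
  ext m
  rw [← inner_fock_left, ← inner_fock_left, inner_pcKraus, inner_smul_right, inner_fock_fock]
  split_ifs with h
  · rw [h, mul_one]
  · rw [pcMatrix_eq_zero κ (by omega), mul_zero, Complex.ofReal_zero]

theorem adjoint_pcKraus_fock (κ : ℝ) (ℓ m : ℕ) :
    ContinuousLinearMap.adjoint (pcKraus κ 0 ℓ) (fock m) =
      if m ≤ ℓ then ((pcMatrix κ m ℓ (ℓ - m) 0 : ℝ) : ℂ) • fock (ℓ - m) else 0 := by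
  ext k
  rw [← inner_fock_left, ← inner_fock_left, ContinuousLinearMap.adjoint_inner_right,
    ← inner_conj_symm, inner_pcKraus, Complex.conj_ofReal]
  split_ifs with h
  · rw [inner_smul_right, inner_fock_fock]
    split_ifs with hk
    · rw [hk, mul_one]
    · rw [pcMatrix_eq_zero κ (by omega), mul_zero, Complex.ofReal_zero]
  · rw [pcMatrix_eq_zero κ (by omega), inner_zero_right, Complex.ofReal_zero]

theorem adjoint_pcKraus (κ : ℝ) (n ℓ : ℕ) :
    ContinuousLinearMap.adjoint (pcKraus κ n ℓ) =
      ∑ p ∈ Finset.HasAntidiagonal.antidiagonal (n + ℓ),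
        ((pcMatrix κ p.1 ℓ p.2 n : ℝ) : ℂ) • ketBra (fock p.2) (fock p.1) := by
  unfold pcKraus
  rw [map_sum]
  refine Finset.sum_congr rfl fun p _ => ?_
  rw [LinearIsometryEquiv.map_smulₛₗ, InnerProductSpace.adjoint_rankOne, Complex.conj_ofReal]

end MatrixElements

/-! ### The output on the vacuum input -/

section VacuumInput

/-- Each Kraus operator sends `|0⟩` to a multiple of `|n+ℓ⟩`. The norms of the terms are negative
binomial probabilities, so the series converges in operator norm. -/
theorem hasSum_phaseConj_vacuum (κ : ℝ) (n : ℕ) :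
    HasSum (fun ℓ : ℕ => ((pcMatrix κ (n + ℓ) ℓ 0 n ^ 2 : ℝ) : ℂ) •
        ketBra (fock (n + ℓ)) (fock (n + ℓ)))
      (phaseConj κ n (ketBra (fock 0) (fock 0))) := by
  have h : ∀ ℓ, pcKraus κ n ℓ ∘L ketBra (fock 0) (fock 0) ∘L
      ContinuousLinearMap.adjoint (pcKraus κ n ℓ) =
      ((pcMatrix κ (n + ℓ) ℓ 0 n ^ 2 : ℝ) : ℂ) • ketBra (fock (n + ℓ)) (fock (n + ℓ)) := by
    intro ℓ
    rw [InnerProductSpace.rankOne_comp, ContinuousLinearMap.adjoint_adjoint,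
      InnerProductSpace.comp_rankOne, pcKraus_fock_zero, map_smulₛₗ, map_smulₛₗ,
      smul_apply, smul_smul, Complex.conj_ofReal, RingHom.id_apply, ← Complex.ofReal_mul, ← sq]
  unfold phaseConj
  simp only [h]
  refine Summable.hasSum (Summable.of_norm ?_)
  refine (hasSum_pcMatrix_vacuum_system_sq κ n).summable.congr fun ℓ => ?_
  rw [norm_smul, InnerProductSpace.norm_rankOne, norm_fock, Complex.norm_real, mul_one, mul_one,
    Real.norm_eq_abs, abs_of_nonneg (sq_nonneg _)]

theorem hasSum_inner_phaseConj_vacuum (κ : ℝ) (n : ℕ) (x y : Mode) :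
    HasSum (fun ℓ : ℕ => ((pcMatrix κ (n + ℓ) ℓ 0 n ^ 2 : ℝ) : ℂ) *
        (⟪x, fock (n + ℓ)⟫_ℂ * ⟪fock (n + ℓ), y⟫_ℂ))
      ⟪x, phaseConj κ n (ketBra (fock 0) (fock 0)) y⟫_ℂ := by
  have h := (matrixElement x y).hasSum (hasSum_phaseConj_vacuum κ n)
  simpa only [map_smul, matrixElement_apply, inner_ketBra, smul_eq_mul] using h

theorem inner_phaseConj_vacuum_of_lt (κ : ℝ) {n τ : ℕ} (h : τ < n) :
    ⟪fock τ, phaseConj κ n (ketBra (fock 0) (fock 0)) (fock τ)⟫_ℂ = 0 := by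
  refine (hasSum_inner_phaseConj_vacuum κ n (fock τ) (fock τ)).unique ?_
  refine hasSum_zero.congr_fun fun ℓ => ?_
  rw [inner_fock_fock, if_neg (by omega), zero_mul, mul_zero]

theorem inner_phaseConj_vacuum_add (κ : ℝ) (n ℓ : ℕ) :
    ⟪fock (n + ℓ), phaseConj κ n (ketBra (fock 0) (fock 0)) (fock (n + ℓ))⟫_ℂ =
      ((pcMatrix κ (n + ℓ) ℓ 0 n ^ 2 : ℝ) : ℂ) := by
  refine (hasSum_inner_phaseConj_vacuum κ n _ _).unique ?_
  convert hasSum_single ℓ ?_ using 1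
  · rw [inner_fock_fock, if_pos rfl, mul_one, mul_one]
  · intro ℓ' h
    rw [inner_fock_fock, if_neg (by omega), zero_mul, mul_zero]

theorem isState_phaseConj_vacuum (κ : ℝ) (n : ℕ) :
    IsState (phaseConj κ n (ketBra (fock 0) (fock 0))) := by
  constructor
  · rw [ContinuousLinearMap.isPositive_iff_complex]
    intro x
    have h := hasSum_inner_phaseConj_vacuum κ n x x
    have h1 : ∀ ℓ : ℕ, ((pcMatrix κ (n + ℓ) ℓ 0 n ^ 2 : ℝ) : ℂ) *
        (⟪x, fock (n + ℓ)⟫_ℂ * ⟪fock (n + ℓ), x⟫_ℂ) =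
        ((pcMatrix κ (n + ℓ) ℓ 0 n ^ 2 * ‖⟪fock (n + ℓ), x⟫_ℂ‖ ^ 2 : ℝ) : ℂ) := by
      intro ℓ
      rw [← inner_conj_symm x, Complex.conj_mul']
      push_cast
      rfl
    simp only [h1] at h
    have hre := Complex.hasSum_re h
    have him := Complex.hasSum_im h
    simp only [Complex.ofReal_re, Complex.ofReal_im] at hre him
    have him0 := him.unique hasSum_zero
    have hre0 := hre.nonneg fun ℓ => by positivity
    rw [← inner_conj_symm]
    refine ⟨?_, by rwa [RCLike.conj_re]⟩
    rw [RCLike.conj_re, Complex.conj_eq_iff_im.2 him0]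
    exact Complex.ext rfl him0.symm
  · have hinj : Function.Injective fun ℓ : ℕ => n + ℓ := fun a b h => by simpa using h
    rw [← hinj.hasSum_iff]
    · have h := hasSum_pcMatrix_vacuum_system_sq κ n
      rw [← Complex.hasSum_ofReal, Complex.ofReal_one] at h
      refine h.congr_fun fun ℓ => ?_
      exact inner_phaseConj_vacuum_add κ n ℓ
    · intro τ hτ
      refine inner_phaseConj_vacuum_of_lt κ ?_
      by_contra hn
      exact hτ ⟨τ - n, by simp only; omega⟩

end VacuumInput

/-! ### Convergence of the Kraus series for the vacuum environment -/

section Convergence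

/-- A positive operator is the square of a self-adjoint one. -/
theorem exists_selfAdjoint_comp_self_eq {H : Type*} [NormedAddCommGroup H] [InnerProductSpace ℂ H]
    [CompleteSpace H] {ρ : H →L[ℂ] H} (hρ : ρ.IsPositive) :
    ∃ T : H →L[ℂ] H, ContinuousLinearMap.adjoint T = T ∧ T ∘L T = ρ := by
  have h0 : 0 ≤ ρ := (ContinuousLinearMap.nonneg_iff_isPositive ρ).2 hρ
  have hsa : IsSelfAdjoint (CFC.sqrt ρ) := (CFC.sqrt_nonneg ρ).isSelfAdjoint
  exact ⟨CFC.sqrt ρ, hsa, CFC.sqrt_mul_sqrt_self ρ h0⟩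

/-- Turns the trace into a Hilbert–Schmidt sum, so that no trace-class theory is needed. -/
theorem IsState.exists_sqrt {ρ : Mode →L[ℂ] Mode} (hρ : IsState ρ) :
    ∃ T : Mode →L[ℂ] Mode, ContinuousLinearMap.adjoint T = T ∧ T ∘L T = ρ ∧
      HasSum (fun k => ‖T (fock k)‖ ^ 2) 1 := by
  obtain ⟨T, hadj, hmul⟩ := exists_selfAdjoint_comp_self_eq hρ.1
  refine ⟨T, hadj, hmul, ?_⟩
  have h := hρ.2
  rw [← Complex.ofReal_one] at h
  rw [← Complex.hasSum_ofReal]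
  refine h.congr_fun fun k => ?_
  rw [← hmul, ContinuousLinearMap.comp_apply, ← ContinuousLinearMap.adjoint_inner_left, hadj,
    inner_self_eq_norm_sq_to_K]
  push_cast
  rfl

theorem sum_antidiagonal_norm_sq_le (x : Mode) (ℓ : ℕ) :
    ∑ p ∈ Finset.HasAntidiagonal.antidiagonal ℓ, ‖x p.1‖ ^ 2 ≤ ‖x‖ ^ 2 := by
  rw [Finset.Nat.sum_antidiagonal_eq_sum_range_succ (fun i _ => ‖x i‖ ^ 2)]
  have h := lp.hasSum_norm (p := 2) (by norm_num) x
  simp only [ENNReal.toReal_ofNat, Real.rpow_two] at h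
  exact sum_le_hasSum _ (fun i _ => by positivity) h

/-- The term is `B†B` with `B = T C_ℓ†`, and Cauchy–Schwarz over the antidiagonal bounds `‖B‖²`.
With `ρ = T²` the bound is the trace of the term, which is summable over `ℓ`. -/
theorem norm_pcKraus_conj_le (κ : ℝ) (ℓ : ℕ) {T : Mode →L[ℂ] Mode}
    (hT : ContinuousLinearMap.adjoint T = T) :
    ‖pcKraus κ 0 ℓ ∘L (T ∘L T) ∘L ContinuousLinearMap.adjoint (pcKraus κ 0 ℓ)‖ ≤
      ∑ p ∈ Finset.HasAntidiagonal.antidiagonal ℓ,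
        pcMatrix κ p.1 (p.1 + p.2) p.2 0 ^ 2 * ‖T (fock p.2)‖ ^ 2 := by
  set B : Mode →L[ℂ] Mode := T ∘L ContinuousLinearMap.adjoint (pcKraus κ 0 ℓ) with hB
  set S : ℝ := ∑ p ∈ Finset.HasAntidiagonal.antidiagonal ℓ,
        pcMatrix κ p.1 (p.1 + p.2) p.2 0 ^ 2 * ‖T (fock p.2)‖ ^ 2 with hS
  have hS0 : 0 ≤ S := Finset.sum_nonneg fun p _ => by positivity
  have h1 : pcKraus κ 0 ℓ ∘L (T ∘L T) ∘L ContinuousLinearMap.adjoint (pcKraus κ 0 ℓ) =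
      ContinuousLinearMap.adjoint B ∘L B := by
    rw [hB, ContinuousLinearMap.adjoint_comp, hT, ContinuousLinearMap.adjoint_adjoint]
    rfl
  have h2 : ‖B‖ ≤ Real.sqrt S := by
    refine ContinuousLinearMap.opNorm_le_bound _ (Real.sqrt_nonneg _) fun x => ?_
    refine abs_le_of_sq_le_sq' ?_ (by positivity) |>.2
    rw [mul_pow, Real.sq_sqrt hS0]
    have hBx : B x = ∑ p ∈ Finset.HasAntidiagonal.antidiagonal ℓ,
        ((pcMatrix κ p.1 (p.1 + p.2) p.2 0 : ℝ) : ℂ) • x p.1 • T (fock p.2) := by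
      rw [hB, adjoint_pcKraus, ContinuousLinearMap.comp_apply, sum_apply, map_sum, zero_add]
      refine Finset.sum_congr rfl fun p hp => ?_
      rw [Finset.HasAntidiagonal.mem_antidiagonal] at hp
      rw [smul_apply, map_smul, InnerProductSpace.rankOne_apply, map_smul, inner_fock_left, hp]
    have hle : ‖B x‖ ≤ ∑ p ∈ Finset.HasAntidiagonal.antidiagonal ℓ,
        (|pcMatrix κ p.1 (p.1 + p.2) p.2 0| * ‖T (fock p.2)‖) * ‖x p.1‖ := by
      rw [hBx]
      refine (norm_sum_le _ _).trans (Finset.sum_le_sum fun p _ => ?_)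
      rw [norm_smul, norm_smul, Complex.norm_real, Real.norm_eq_abs]
      exact le_of_eq (by ring)
    calc ‖B x‖ ^ 2 ≤ _ := pow_le_pow_left₀ (norm_nonneg _) hle 2
      _ ≤ _ := Finset.sum_mul_sq_le_sq_mul_sq _ _ _
      _ ≤ S * ‖x‖ ^ 2 := by
        refine mul_le_mul (le_of_eq ?_) (sum_antidiagonal_norm_sq_le x ℓ)
          (Finset.sum_nonneg fun p _ => by positivity) hS0
        refine Finset.sum_congr rfl fun p _ => ?_
        rw [mul_pow, sq_abs]
  rw [h1]
  refine (ContinuousLinearMap.opNorm_comp_le _ _).trans ?_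
  rw [LinearIsometryEquiv.norm_map]
  calc ‖B‖ * ‖B‖ ≤ Real.sqrt S * Real.sqrt S :=
        mul_le_mul h2 h2 (norm_nonneg _) (Real.sqrt_nonneg _)
    _ = S := Real.mul_self_sqrt hS0

theorem hasSum_pcMatrix_sq_mul (κ : ℝ) {p : ℕ → ℝ} (hp0 : ∀ k, 0 ≤ p k) (hp : HasSum p 1) :
    HasSum (fun q : ℕ × ℕ => pcMatrix κ q.1 (q.1 + q.2) q.2 0 ^ 2 * p q.2) 1 := by
  have hf : ∀ k, HasSum (fun m => pcMatrix κ m (m + k) k 0 ^ 2 * p k) (p k) := by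
    intro k
    simpa using (hasSum_pcMatrix_vacuum_environment_sq κ k).mul_right (p k)
  -- Sum over the output index first: for fixed input `k` this gives total mass `p k`.
  rw [← (Equiv.prodComm ℕ ℕ).hasSum_iff]
  have hs : Summable ((fun q : ℕ × ℕ => pcMatrix κ q.1 (q.1 + q.2) q.2 0 ^ 2 * p q.2) ∘
      (Equiv.prodComm ℕ ℕ)) := by
    refine (summable_prod_of_nonneg fun q => mul_nonneg (sq_nonneg _) (hp0 _)).2 ?_
    refine ⟨fun k => (hf k).summable, ?_⟩
    refine hp.summable.congr fun k => ?_
    exact (hf k).tsum_eq.symm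
  have h := hs.hasSum
  rwa [(h.prod_fiberwise hf).unique hp] at h

theorem hasSum_phaseConj_zero (κ : ℝ) {ρ : Mode →L[ℂ] Mode} (hρ : IsState ρ) :
    HasSum (fun ℓ => pcKraus κ 0 ℓ ∘L ρ ∘L ContinuousLinearMap.adjoint (pcKraus κ 0 ℓ))
      (phaseConj κ 0 ρ) := by
  obtain ⟨T, hT, rfl, hs⟩ := hρ.exists_sqrt
  refine Summable.hasSum (Summable.of_norm_bounded ?_ fun ℓ => norm_pcKraus_conj_le κ ℓ hT)
  have h := (hasSum_pcMatrix_sq_mul κ (fun k => sq_nonneg ‖T (fock k)‖) hs).summable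
  -- The antidiagonals `m + k = ℓ` partition `ℕ × ℕ`, so the bounds add up to the convergent double
  -- sum.
  rw [← Finset.HasAntidiagonal.sigmaAntidiagonalEquivProd.summable_iff] at h
  refine (h.sigma' fun ℓ => (hasSum_fintype _).summable).congr fun ℓ => ?_
  rw [tsum_fintype]
  exact Finset.sum_finset_coe (fun q : ℕ × ℕ =>
    pcMatrix κ q.1 (q.1 + q.2) q.2 0 ^ 2 * ‖T (fock q.2)‖ ^ 2) _

end Convergence

/-! ### Fock matrix elements of the output -/

section OutputMatrix

theorem inner_pcKraus_conj (κ : ℝ) (ℓ m m' : ℕ) (ρ : Mode →L[ℂ] Mode) :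
    ⟪fock m, (pcKraus κ 0 ℓ ∘L ρ ∘L ContinuousLinearMap.adjoint (pcKraus κ 0 ℓ)) (fock m')⟫_ℂ =
      if m ≤ ℓ ∧ m' ≤ ℓ then
        ((pcMatrix κ m ℓ (ℓ - m) 0 * pcMatrix κ m' ℓ (ℓ - m') 0 : ℝ) : ℂ) *
          ⟪fock (ℓ - m), ρ (fock (ℓ - m'))⟫_ℂ
      else 0 := by
  rw [ContinuousLinearMap.comp_apply, ContinuousLinearMap.comp_apply,
    ← ContinuousLinearMap.adjoint_inner_left, adjoint_pcKraus_fock, adjoint_pcKraus_fock]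
  by_cases h : m ≤ ℓ
  · by_cases h' : m' ≤ ℓ
    · rw [if_pos h, if_pos h', if_pos ⟨h, h'⟩, map_smul, inner_smul_left, inner_smul_right,
        Complex.conj_ofReal]
      push_cast
      ring
    · simp [h']
  · simp [h]

theorem hasSum_inner_phaseConj_zero (κ : ℝ) {ρ : Mode →L[ℂ] Mode} (hρ : IsState ρ) (m m' : ℕ) :
    HasSum (fun i : ℕ =>
      ((pcMatrix κ m (m + (m' - m + i)) (m' - m + i) 0 *
        pcMatrix κ m' (m' + (m - m' + i)) (m - m' + i) 0 : ℝ) : ℂ) *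
          ⟪fock (m' - m + i), ρ (fock (m - m' + i))⟫_ℂ)
      ⟪fock m, phaseConj κ 0 ρ (fock m')⟫_ℂ := by
  have h := (matrixElement (fock m) (fock m')).hasSum (hasSum_phaseConj_zero κ hρ)
  simp only [matrixElement_apply, inner_pcKraus_conj] at h
  -- With truncated subtraction `m + (m' - m + i) = max m m' + i`: exactly the `ℓ` for which both `ℓ
  -- - m` and `ℓ - m'` are natural numbers.
  have hinj : Function.Injective fun i : ℕ => m + (m' - m + i) := fun a b h => by
    simp only at h
    omega
  rw [← hinj.hasSum_iff] at h
  · refine h.congr_fun fun i => ?_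
    simp only [Function.comp_apply]
    rw [if_pos (by omega), show m + (m' - m + i) - m = m' - m + i by omega,
      show m + (m' - m + i) - m' = m - m' + i by omega,
      show m' + (m - m' + i) = m + (m' - m + i) by omega]
  · intro ℓ hℓ
    refine if_neg fun hm => hℓ ⟨ℓ - m - (m' - m), ?_⟩
    simp only
    omega

/-- The double sum restricted to `m + j = m' + k` is the form in which the Gaussian integral
delivers the matrix element. -/
theorem inner_phaseConj_zero_eq_of_hasSum (κ : ℝ) {ρ : Mode →L[ℂ] Mode} (hρ : IsState ρ)
    (m m' : ℕ) {S : ℂ}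
    (hS : HasSum (fun p : ℕ × ℕ => if m + p.1 = m' + p.2 then
      ((pcMatrix κ m (m + p.1) p.1 0 * pcMatrix κ m' (m' + p.2) p.2 0 : ℝ) : ℂ) *
        ⟪fock p.1, ρ (fock p.2)⟫_ℂ else 0) S) :
    ⟪fock m, phaseConj κ 0 ρ (fock m')⟫_ℂ = S := by
  have hinj : Function.Injective fun i : ℕ => (m' - m + i, m - m' + i) := fun a b h => by
    simpa using h
  rw [← hinj.hasSum_iff] at hS
  · refine (hasSum_inner_phaseConj_zero κ hρ m m').unique (hS.congr_fun fun i => ?_)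
    simp only [Function.comp_apply]
    rw [if_pos (by omega)]
  · rintro ⟨j, k⟩ hp
    refine if_neg fun hm => hp ⟨j - (m' - m), ?_⟩
    simp only at hm ⊢
    rw [Prod.mk.injEq]
    omega

theorem ofReal_re_inner_of_isPositive {A : Mode →L[ℂ] Mode} (hA : A.IsPositive) (x : Mode) :
    (((⟪x, A x⟫_ℂ).re : ℝ) : ℂ) = ⟪x, A x⟫_ℂ :=
  Complex.ext rfl (Complex.nonneg_iff.1 (hA.inner_nonneg_right x)).2

theorem re_inner_nonneg_of_isPositive {A : Mode →L[ℂ] Mode} (hA : A.IsPositive) (x : Mode) :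
    0 ≤ (⟪x, A x⟫_ℂ).re :=
  (Complex.nonneg_iff.1 (hA.inner_nonneg_right x)).1

/-- Trace preservation: the double sum of total mass one, now summed over the input index first. -/
theorem hasSum_re_inner_phaseConj_zero (κ : ℝ) {ρ : Mode →L[ℂ] Mode} (hρ : IsState ρ) :
    HasSum (fun m => (⟪fock m, phaseConj κ 0 ρ (fock m)⟫_ℂ).re) 1 := by
  have htr : HasSum (fun k => (⟪fock k, ρ (fock k)⟫_ℂ).re) 1 := by
    simpa using Complex.hasSum_re hρ.2
  refine (hasSum_pcMatrix_sq_mul κ (fun k => re_inner_nonneg_of_isPositive hρ.1 (fock k))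
    htr).prod_fiberwise fun m => ?_
  have h := Complex.hasSum_re (hasSum_inner_phaseConj_zero κ hρ m m)
  refine h.congr_fun fun k => ?_
  simp only [Nat.sub_self, zero_add]
  rw [Complex.re_ofReal_mul, sq]

theorem pcMatrix_zero_vacuum_environment (m k : ℕ) :
    pcMatrix 0 m (m + k) k 0 = if m = 0 then 1 else 0 := by
  rw [pcMatrix_vacuum_environment]
  split_ifs with h
  · subst h
    have : (k.factorial : ℝ) ≠ 0 := by positivity
    simp [this]
  · simp [h]

theorem phaseConj_zero_zero {ρ : Mode →L[ℂ] Mode} (hρ : IsState ρ) :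
    phaseConj 0 0 ρ = ketBra (fock 0) (fock 0) := by
  refine ext_fock fun m m' => (hasSum_inner_phaseConj_zero 0 hρ m m').unique ?_
  simp only [pcMatrix_zero_vacuum_environment]
  rw [inner_ketBra, inner_fock_fock, inner_fock_fock]
  by_cases h : m = 0
  · by_cases h' : m' = 0
    · subst h h'
      simpa using hρ.2
    · simp [h', Ne.symm h', hasSum_zero]
  · simp [h, hasSum_zero]

end OutputMatrix

/-! ### Fock expansion of the Husimi function -/

section Husimi

/-- Absolute summability, stronger than square summability, makes the double Fock expansion of `Q`
converge for any bounded operator. With `t = |β|ᵏ/√k!`, the bound is `t = (2ᵏt)(2⁻ᵏ) ≤ (2ᵏt)² +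
4⁻ᵏ`. -/
theorem summable_norm_coherent (β : ℂ) : Summable fun k => ‖coherent β k‖ := by
  have h1 : Summable fun k : ℕ => (4 * ‖β‖ ^ 2) ^ k / (k.factorial : ℝ) :=
    Real.summable_pow_div_factorial _
  have h2 : Summable fun k : ℕ => (1 / 4 : ℝ) ^ k :=
    summable_geometric_of_lt_one (by norm_num) (by norm_num)
  refine Summable.of_nonneg_of_le (fun k => norm_nonneg _) (fun k => ?_)
    ((h1.add h2).mul_left (Real.exp (-‖β‖ ^ 2 / 2)))
  rw [coherent_apply, norm_div, norm_mul, Complex.norm_real, Complex.norm_real, norm_pow,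
    Real.norm_eq_abs, Real.abs_exp, Real.norm_eq_abs, abs_of_nonneg (Real.sqrt_nonneg _),
    mul_div_assoc]
  refine mul_le_mul_of_nonneg_left ?_ (Real.exp_pos _).le
  have hk : Real.sqrt (k.factorial : ℝ) ^ 2 = k.factorial := Real.sq_sqrt (Nat.cast_nonneg _)
  have e1 : (4 * ‖β‖ ^ 2) ^ k / (k.factorial : ℝ) =
      (2 ^ k * (‖β‖ ^ k / Real.sqrt (k.factorial : ℝ))) ^ 2 := by
    rw [mul_pow, mul_pow, div_pow, hk, show (4 : ℝ) = 2 ^ 2 by norm_num, ← pow_mul, ← pow_mul,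
      ← pow_mul, ← pow_mul, mul_comm 2 k]
    ring
  have e2 : (1 / 4 : ℝ) ^ k = ((1 / 2) ^ k) ^ 2 := by
    rw [← pow_mul, mul_comm k, pow_mul]
    norm_num
  have e3 : (2 : ℝ) ^ k * (1 / 2) ^ k = 1 := by
    rw [← mul_pow]
    norm_num
  rw [e1, e2]
  set t := ‖β‖ ^ k / Real.sqrt (k.factorial : ℝ) with ht
  have ht0 : 0 ≤ t := by positivity
  have : t = (2 ^ k * t) * (1 / 2) ^ k := by rw [mul_right_comm, e3, one_mul]
  nlinarith [sq_nonneg (2 ^ k * t - (1 / 2) ^ k), sq_nonneg (2 ^ k * t), sq_nonneg ((1 / 2 : ℝ) ^ k)]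

/-- The expansion of a quadratic form in the Fock basis. -/
theorem hasSum_inner_of_summable_norm (A : Mode →L[ℂ] Mode) {x : Mode}
    (hx : Summable fun k => ‖x k‖) :
    HasSum (fun p : ℕ × ℕ => conj (x p.1) * x p.2 * ⟪fock p.1, A (fock p.2)⟫_ℂ) ⟪x, A x⟫_ℂ := by
  have hs : Summable fun p : ℕ × ℕ => conj (x p.1) * x p.2 * ⟪fock p.1, A (fock p.2)⟫_ℂ := by
    refine Summable.of_norm_bounded ((hx.mul_of_nonneg hx (fun k => norm_nonneg _)
      fun k => norm_nonneg _).mul_right ‖A‖) fun p => ?_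
    rw [norm_mul, norm_mul, RCLike.norm_conj]
    refine mul_le_mul_of_nonneg_left ?_ (by positivity)
    refine (norm_inner_le_norm _ _).trans ?_
    rw [norm_fock, one_mul]
    exact (A.le_opNorm _).trans (by rw [norm_fock, mul_one])
  have h1 : ∀ j, HasSum (fun k => conj (x j) * x k * ⟪fock j, A (fock k)⟫_ℂ)
      (conj (x j) * ⟪fock j, A x⟫_ℂ) := by
    intro j
    have h := ((innerSL ℂ (fock j)) ∘L A).hasSum (hasSum_smul_fock x)
    refine (h.mul_left (conj (x j))).congr_fun fun k => ?_
    rw [map_smul, smul_eq_mul, mul_assoc]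
    rfl
  have h2 : HasSum (fun j => conj (x j) * ⟪fock j, A x⟫_ℂ) ⟪x, A x⟫_ℂ := by
    refine (lp.hasSum_inner x (A x)).congr_fun fun j => ?_
    rw [inner_fock_left, RCLike.inner_apply, mul_comm]
  have h := hs.hasSum
  rwa [(h.prod_fiberwise h1).unique h2] at h

theorem hasSum_husimiQ (A : Mode →L[ℂ] Mode) (β : ℂ) :
    HasSum (fun p : ℕ × ℕ => conj (coherent β p.1) * coherent β p.2 *
      ⟪fock p.1, A (fock p.2)⟫_ℂ) (husimiQ A β) :=
  hasSum_inner_of_summable_norm A (summable_norm_coherent β)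

theorem continuous_husimiQ (A : Mode →L[ℂ] Mode) : Continuous (husimiQ A) :=
  continuous_coherent.inner (A.continuous.comp continuous_coherent)

theorem norm_husimiQ_le (A : Mode →L[ℂ] Mode) (β : ℂ) : ‖husimiQ A β‖ ≤ ‖A‖ := by
  refine (norm_inner_le_norm _ _).trans ?_
  rw [norm_coherent, one_mul]
  exact (A.le_opNorm _).trans (by rw [norm_coherent, mul_one])

end Husimi

/-! ### Exchanging the Fock sum and the Gaussian integral -/

section Exchange

/-- Two uses of `xy ≤ x² + y²` separate `j` from `k` and leave even powers of `|z|`, whose Gaussian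
moments are known. -/
theorem norm_pow_mul_conj_pow_mul_exp_le (m m' j k : ℕ) (z : ℂ) :
    ‖z ^ (m + j) * conj z ^ (m' + k) * ((Real.exp (-‖z‖ ^ 2) : ℝ) : ℂ)‖ ≤
      Real.sqrt j.factorial * Real.sqrt k.factorial *
        ((‖z‖ ^ (2 * j) + ‖z‖ ^ (2 * (m + m' + j))) * Real.exp (-‖z‖ ^ 2) / j.factorial +
          (‖z‖ ^ (2 * k) + ‖z‖ ^ (2 * (m + m' + k))) * Real.exp (-‖z‖ ^ 2) / k.factorial) := by
  simp only [norm_mul, norm_pow, RCLike.norm_conj, Complex.norm_real, Real.norm_eq_abs,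
    Real.abs_exp]
  have hj : Real.sqrt j.factorial ^ 2 = j.factorial := Real.sq_sqrt (Nat.cast_nonneg _)
  have hk : Real.sqrt k.factorial ^ 2 = k.factorial := Real.sq_sqrt (Nat.cast_nonneg _)
  have ha : 0 < Real.sqrt j.factorial := Real.sqrt_pos.2 (by positivity)
  have hb : 0 < Real.sqrt k.factorial := Real.sqrt_pos.2 (by positivity)
  rw [← hj, ← hk]
  generalize Real.sqrt j.factorial = a at ha
  generalize Real.sqrt k.factorial = b at hb
  have hr := norm_nonneg z
  have he := (Real.exp_pos (-‖z‖ ^ 2)).le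
  generalize Real.exp (-‖z‖ ^ 2) = e at he
  generalize ‖z‖ = r at hr
  have e1 : r ^ (m + j) * r ^ (m' + k) * e =
      a * b * e * (r ^ (m + m') * ((r ^ j / a) * (r ^ k / b))) := by
    field_simp
    ring
  have e2 : a * b * ((r ^ (2 * j) + r ^ (2 * (m + m' + j))) * e / a ^ 2 +
      (r ^ (2 * k) + r ^ (2 * (m + m' + k))) * e / b ^ 2) =
      a * b * e * ((1 + (r ^ (m + m')) ^ 2) * ((r ^ j / a) ^ 2 + (r ^ k / b) ^ 2)) := by
    field_simp
    ring
  rw [Real.sqrt_sq ha.le, Real.sqrt_sq hb.le, e1, e2]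
  refine mul_le_mul_of_nonneg_left ?_ (by positivity)
  refine mul_le_mul ?_ ?_ (by positivity) (by positivity)
  · nlinarith [sq_nonneg (r ^ (m + m') - 1), sq_nonneg (r ^ (m + m'))]
  · nlinarith [sq_nonneg (r ^ j / a - r ^ k / b), sq_nonneg (r ^ j / a), sq_nonneg (r ^ k / b)]

theorem integral_norm_pow_mul_conj_pow_mul_exp_le (m m' j k : ℕ) :
    ∫ z : ℂ, ‖z ^ (m + j) * conj z ^ (m' + k) * ((Real.exp (-‖z‖ ^ 2) : ℝ) : ℂ)‖ ≤
      Real.sqrt j.factorial * Real.sqrt k.factorial *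
        (Real.pi * (1 + (m + m').factorial * (j + (m + m')).choose (m + m')) +
          Real.pi * (1 + (m + m').factorial * (k + (m + m')).choose (m + m'))) := by
  have hint : ∀ i : ℕ, Integrable fun z : ℂ =>
      (‖z‖ ^ (2 * i) + ‖z‖ ^ (2 * (m + m' + i))) * Real.exp (-‖z‖ ^ 2) / i.factorial := by
    intro i
    simp only [add_mul]
    exact ((integrable_norm_pow_mul_exp_neg_sq i).add
      (integrable_norm_pow_mul_exp_neg_sq (m + m' + i))).div_const _
  have hval : ∀ i : ℕ, ∫ z : ℂ,
      (‖z‖ ^ (2 * i) + ‖z‖ ^ (2 * (m + m' + i))) * Real.exp (-‖z‖ ^ 2) / i.factorial =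
      Real.pi * (1 + (m + m').factorial * (i + (m + m')).choose (m + m')) := by
    intro i
    simp only [add_mul]
    rw [integral_div, integral_add (integrable_norm_pow_mul_exp_neg_sq i)
      (integrable_norm_pow_mul_exp_neg_sq (m + m' + i)), integral_norm_pow_mul_exp_neg_sq,
      integral_norm_pow_mul_exp_neg_sq, Nat.cast_choose ℝ (Nat.le_add_left _ _),
      Nat.add_sub_cancel, add_comm i]
    have h1 : (i.factorial : ℝ) ≠ 0 := by positivity
    have h2 : ((m + m').factorial : ℝ) ≠ 0 := by positivity
    field_simp
  rw [← hval, ← hval, ← integral_add (hint j) (hint k), ← integral_const_mul]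
  refine integral_mono (integrable_pow_mul_conj_pow_mul_exp_neg_sq _ _).norm
    (((hint j).add (hint k)).const_mul _) fun z => ?_
  exact norm_pow_mul_conj_pow_mul_exp_le m m' j k z

/-- After division by the square roots of factorials the moments grow only polynomially in `j` and
`k`, and `c < 1` beats them. -/
theorem summable_integral_norm (m m' : ℕ) {c : ℝ} (hc0 : 0 ≤ c) (hc1 : c < 1) :
    Summable fun p : ℕ × ℕ => c ^ p.1 * c ^ p.2 /
      (Real.sqrt p.1.factorial * Real.sqrt p.2.factorial) *
      ∫ z : ℂ, ‖z ^ (m + p.1) * conj z ^ (m' + p.2) * ((Real.exp (-‖z‖ ^ 2) : ℝ) : ℂ)‖ := by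
  have hc : ‖c‖ < 1 := by rwa [Real.norm_eq_abs, abs_of_nonneg hc0]
  have hgeo : Summable fun k : ℕ => c ^ k := summable_geometric_of_lt_one hc0 hc1
  set h : ℕ → ℝ := fun i =>
    Real.pi * (1 + (m + m').factorial * (i + (m + m')).choose (m + m')) with hh
  have hh0 : ∀ i, 0 ≤ h i := fun i => by positivity
  have hsum : Summable fun i => c ^ i * h i := by
    have := (hgeo.add ((summable_choose_mul_geometric_of_norm_lt_one (m + m') hc).mul_left
      ((m + m').factorial : ℝ))).mul_left Real.pi
    refine this.congr fun i => ?_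
    simp only [hh]
    ring
  have hS : Summable fun p : ℕ × ℕ => c ^ p.1 * h p.1 * c ^ p.2 + c ^ p.1 * (c ^ p.2 * h p.2) := by
    refine Summable.add ?_ ?_
    · exact hsum.mul_of_nonneg hgeo (fun i => mul_nonneg (pow_nonneg hc0 i) (hh0 i))
        fun i => pow_nonneg hc0 i
    · exact hgeo.mul_of_nonneg hsum (fun i => pow_nonneg hc0 i)
        fun i => mul_nonneg (pow_nonneg hc0 i) (hh0 i)
  refine Summable.of_nonneg_of_le (fun p => ?_) (fun p => ?_) hS
  · exact mul_nonneg (by positivity) (integral_nonneg fun z => norm_nonneg _)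
  · have hj : 0 < Real.sqrt p.1.factorial := Real.sqrt_pos.2 (by positivity)
    have hk : 0 < Real.sqrt p.2.factorial := Real.sqrt_pos.2 (by positivity)
    refine (mul_le_mul_of_nonneg_left (integral_norm_pow_mul_conj_pow_mul_exp_le m m' p.1 p.2)
      (by positivity)).trans (le_of_eq ?_)
    simp only [hh]
    field_simp

theorem sqrt_factorial_div (m k : ℕ) :
    Real.sqrt ((m + k).factorial / (m.factorial * k.factorial)) =
      Real.sqrt (m + k).factorial / (Real.sqrt m.factorial * Real.sqrt k.factorial) := by
  rw [Real.sqrt_div (Nat.cast_nonneg _), Real.sqrt_mul (Nat.cast_nonneg _)]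

/-- The density of the Glauber-Sudarshan weight of the output for the vacuum environment, with
respect to the rescaled Lebesgue measure. -/
noncomputable def outputDensity (κ : ℝ) (ρ : Mode →L[ℂ] Mode) (z : ℂ) : ℝ :=
  (Real.sqrt (1 + κ ^ 2))⁻¹ ^ 2 / Real.pi *
    (husimiQ ρ (((Real.sqrt (1 + κ ^ 2))⁻¹ : ℝ) * conj z)).re

/-- The matrix elements of `∫ |sz⟩⟨sz| Q(c z̄; ρ) c²/π dz`, with `s = κ/√(1+κ²)` and
`c = 1/√(1+κ²)`. -/
theorem hasSum_integral_outputDensity {κ : ℝ} (hκ : 0 < κ) {ρ : Mode →L[ℂ] Mode}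
    (hρ : ρ.IsPositive) (m m' : ℕ) :
    HasSum (fun p : ℕ × ℕ => if m + p.1 = m' + p.2 then
      ((pcMatrix κ m (m + p.1) p.1 0 * pcMatrix κ m' (m' + p.2) p.2 0 : ℝ) : ℂ) *
        ⟪fock p.1, ρ (fock p.2)⟫_ℂ else 0)
      (∫ z : ℂ, (outputDensity κ ρ z : ℂ) *
        (⟪fock m, coherent ((κ / Real.sqrt (1 + κ ^ 2) : ℝ) * z)⟫_ℂ *
          ⟪coherent ((κ / Real.sqrt (1 + κ ^ 2) : ℝ) * z), fock m'⟫_ℂ)) := by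
  have hcs := inv_sqrt_sq_add_div_sqrt_sq κ
  have hc0 : 0 < (Real.sqrt (1 + κ ^ 2))⁻¹ := inv_pos.2 (sqrt_one_add_sq_pos κ)
  have hs0 : 0 < κ / Real.sqrt (1 + κ ^ 2) := div_pos hκ (sqrt_one_add_sq_pos κ)
  simp only [pcMatrix_vacuum_environment, outputDensity, sqrt_factorial_div]
  generalize (Real.sqrt (1 + κ ^ 2))⁻¹ = c at *
  generalize κ / Real.sqrt (1 + κ ^ 2) = s at *
  -- The point where `κ > 0` matters: `s > 0` and `c² + s² = 1`.
  have hc1 : c < 1 := by nlinarith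
  set K : ℕ × ℕ → ℝ := fun p => c ^ 2 / Real.pi * (s ^ m * s ^ m' /
    (Real.sqrt m.factorial * Real.sqrt m'.factorial)) * (c ^ p.1 * c ^ p.2 /
      (Real.sqrt p.1.factorial * Real.sqrt p.2.factorial)) with hK
  set F : ℕ × ℕ → ℂ → ℂ := fun p z => ((K p : ℂ) * ⟪fock p.1, ρ (fock p.2)⟫_ℂ) *
    (z ^ (m + p.1) * conj z ^ (m' + p.2) * ((Real.exp (-‖z‖ ^ 2) : ℝ) : ℂ)) with hF
  have hFint : ∀ p, Integrable (F p) := fun p =>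
    (integrable_pow_mul_conj_pow_mul_exp_neg_sq _ _).const_mul _
  have hFsum : Summable fun p => ∫ z, ‖F p z‖ := by
    refine Summable.of_nonneg_of_le (fun p => integral_nonneg fun z => norm_nonneg _) (fun p => ?_)
      ((summable_integral_norm m m' hc0.le hc1).mul_left (c ^ 2 / Real.pi * (s ^ m * s ^ m' /
        (Real.sqrt m.factorial * Real.sqrt m'.factorial)) * ‖ρ‖))
    simp only [hF]
    simp_rw [norm_mul (_ * ⟪fock p.1, ρ (fock p.2)⟫_ℂ)]
    rw [integral_const_mul, ← mul_assoc]
    refine mul_le_mul_of_nonneg_right ?_ (integral_nonneg fun z => norm_nonneg _)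
    have hKp : 0 ≤ K p := by positivity
    rw [norm_mul, Complex.norm_real, Real.norm_eq_abs, abs_of_nonneg hKp]
    have hle : ‖⟪fock p.1, ρ (fock p.2)⟫_ℂ‖ ≤ ‖ρ‖ := by
      refine (norm_inner_le_norm _ _).trans ?_
      rw [norm_fock, one_mul]
      exact (ρ.le_opNorm _).trans (by rw [norm_fock, mul_one])
    refine (mul_le_mul_of_nonneg_left hle hKp).trans (le_of_eq ?_)
    simp only [hK]
    ring
  have hH := hasSum_integral_of_summable_integral_norm hFint hFsum
  rw [integral_congr_ae (g := fun z => ∑' p, F p z)]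
  · refine hH.congr_fun fun p => ?_
    simp only [hF]
    rw [integral_const_mul, integral_pow_mul_conj_pow_mul_exp_neg_sq]
    split_ifs with h
    · rw [← h]
      have hN : Real.sqrt (m + p.1).factorial * Real.sqrt (m + p.1).factorial =
        (m + p.1).factorial := Real.mul_self_sqrt (Nat.cast_nonneg _)
      rw [mul_right_comm (K p : ℂ), ← Complex.ofReal_mul]
      congr 2
      simp only [hK]
      generalize ((m + p.1).factorial : ℝ) = w at hN
      generalize Real.sqrt w = u at hN
      rw [← hN]
      have := Real.pi_ne_zero
      field_simp
    · rw [mul_zero]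
  · refine Eventually.of_forall fun z => ?_
    beta_reduce
    have hq := hasSum_husimiQ ρ ((c : ℂ) * conj z)
    -- `Q` is real for positive `ρ`, so the real part in the density loses nothing.
    have hre : ((husimiQ ρ ((c : ℂ) * conj z)).re : ℂ) = husimiQ ρ ((c : ℂ) * conj z) :=
      ofReal_re_inner_of_isPositive hρ _
    rw [Complex.ofReal_mul, hre, mul_right_comm]
    refine (HasSum.tsum_eq ?_).symm
    refine (hq.mul_left _).congr_fun fun p => ?_
    -- As `s² + c² = 1`, the normalisations of `|sz⟩` and `|c z̄⟩` combine into the standard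
    -- Gaussian weight.
    have hexp : Real.exp (-‖z‖ ^ 2) = Real.exp (-‖(s : ℂ) * z‖ ^ 2 / 2) ^ 2 *
        Real.exp (-‖(c : ℂ) * conj z‖ ^ 2 / 2) ^ 2 := by
      rw [← Real.exp_nat_mul, ← Real.exp_nat_mul, ← Real.exp_add, norm_mul, norm_mul,
        RCLike.norm_conj, Complex.norm_real, Complex.norm_real, mul_pow, mul_pow,
        Real.norm_eq_abs, Real.norm_eq_abs, sq_abs, sq_abs]
      congr 1
      push_cast
      linear_combination (‖z‖ ^ 2) * hcs
    rw [inner_fock_left, ← inner_conj_symm _ (fock m'), inner_fock_left]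
    simp only [hF, hK, coherent_apply]
    rw [hexp]
    generalize Real.exp (-‖(s : ℂ) * z‖ ^ 2 / 2) = E1
    generalize Real.exp (-‖(c : ℂ) * conj z‖ ^ 2 / 2) = E2
    simp only [map_div₀, map_mul, map_pow, Complex.conj_ofReal, Complex.conj_conj]
    push_cast
    simp only [div_eq_mul_inv, mul_inv, mul_pow, pow_add]
    ring

end Exchange

/-! ### The output as a mixture of coherent states -/

section Classical

theorem outputDensity_nonneg (κ : ℝ) {ρ : Mode →L[ℂ] Mode} (hρ : ρ.IsPositive) (z : ℂ) :
    0 ≤ outputDensity κ ρ z :=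
  mul_nonneg (by positivity) (re_inner_nonneg_of_isPositive hρ _)

theorem continuous_outputDensity (κ : ℝ) (ρ : Mode →L[ℂ] Mode) :
    Continuous (outputDensity κ ρ) := by
  have := continuous_husimiQ ρ
  unfold outputDensity
  fun_prop

theorem outputDensity_le (κ : ℝ) (ρ : Mode →L[ℂ] Mode) (z : ℂ) :
    outputDensity κ ρ z ≤ (Real.sqrt (1 + κ ^ 2))⁻¹ ^ 2 / Real.pi * ‖ρ‖ :=
  mul_le_mul_of_nonneg_left ((Complex.re_le_norm _).trans (norm_husimiQ_le _ _)) (by positivity)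

theorem norm_coherent_sq_apply (α : ℂ) (m : ℕ) :
    ‖coherent α m‖ ^ 2 = ‖α‖ ^ (2 * m) * Real.exp (-‖α‖ ^ 2) / m.factorial := by
  rw [coherent_apply, norm_div, norm_mul, Complex.norm_real, Complex.norm_real, norm_pow,
    Real.norm_eq_abs, Real.abs_exp, Real.norm_eq_abs, abs_of_nonneg (Real.sqrt_nonneg _), div_pow,
    mul_pow, Real.sq_sqrt (Nat.cast_nonneg _), ← Real.exp_nat_mul, ← pow_mul]
  push_cast
  rw [mul_comm m 2, mul_comm (Real.exp _)]
  congr 3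
  ring

theorem integrable_outputDensity_mul {s : ℝ} (hs : s ≠ 0) (κ : ℝ) {ρ : Mode →L[ℂ] Mode}
    (hρ : ρ.IsPositive) (m : ℕ) :
    Integrable fun z : ℂ => outputDensity κ ρ z * ‖coherent ((s : ℂ) * z) m‖ ^ 2 := by
  have h : Integrable fun z : ℂ => ‖coherent ((s : ℂ) * z) m‖ ^ 2 := by
    simp only [norm_coherent_sq_apply]
    have := ((integrable_norm_pow_mul_exp_neg_sq m).div_const (m.factorial : ℝ)).comp_smul hs
    simpa only [Complex.real_smul] using this
  refine h.bdd_mul (c := (Real.sqrt (1 + κ ^ 2))⁻¹ ^ 2 / Real.pi * ‖ρ‖)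
    (continuous_outputDensity κ ρ).aestronglyMeasurable (Eventually.of_forall fun z => ?_)
  rw [Real.norm_eq_abs, abs_of_nonneg (outputDensity_nonneg κ hρ z)]
  exact outputDensity_le κ ρ z

/-- The matrix elements of the output of the channel with vacuum environment. -/
theorem inner_phaseConj_zero_eq_integral {κ : ℝ} (hκ : 0 < κ) {ρ : Mode →L[ℂ] Mode}
    (hρ : IsState ρ) (m m' : ℕ) :
    ⟪fock m, phaseConj κ 0 ρ (fock m')⟫_ℂ =
      ∫ z : ℂ, (outputDensity κ ρ z : ℂ) *
        (⟪fock m, coherent ((κ / Real.sqrt (1 + κ ^ 2) : ℝ) * z)⟫_ℂ *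
          ⟪coherent ((κ / Real.sqrt (1 + κ ^ 2) : ℝ) * z), fock m'⟫_ℂ) :=
  inner_phaseConj_zero_eq_of_hasSum κ hρ m m' (hasSum_integral_outputDensity hκ hρ.1 m m')

theorem hasSum_norm_coherent_sq (α : ℂ) : HasSum (fun m => ‖coherent α m‖ ^ 2) 1 := by
  have h := lp.hasSum_norm (p := 2) (by norm_num) (coherent α)
  simpa only [ENNReal.toReal_ofNat, Real.rpow_two, norm_coherent, one_pow] using h

/-- Inserting `∑ₘ |⟨m|sz⟩|² = 1` and applying Tonelli turns the mass into the trace of the output,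
which is one. -/
theorem lintegral_outputDensity {κ : ℝ} (hκ : 0 < κ) {ρ : Mode →L[ℂ] Mode} (hρ : IsState ρ) :
    ∫⁻ z, ENNReal.ofReal (outputDensity κ ρ z) = 1 := by
  have hs0 : κ / Real.sqrt (1 + κ ^ 2) ≠ 0 := (div_pos hκ (sqrt_one_add_sq_pos κ)).ne'
  have hel := fun m => inner_phaseConj_zero_eq_integral hκ hρ m m
  set s := κ / Real.sqrt (1 + κ ^ 2) with hs
  set G : ℕ → ℂ → ℝ := fun m z => outputDensity κ ρ z * ‖coherent ((s : ℂ) * z) m‖ ^ 2 with hG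
  have hG0 : ∀ m z, 0 ≤ G m z := fun m z =>
    mul_nonneg (outputDensity_nonneg κ hρ.1 z) (sq_nonneg _)
  have hGint : ∀ m, Integrable (G m) := integrable_outputDensity_mul hs0 κ hρ.1
  have h1 : ∀ z, ENNReal.ofReal (outputDensity κ ρ z) = ∑' m, ENNReal.ofReal (G m z) := by
    intro z
    have h := (hasSum_norm_coherent_sq ((s : ℂ) * z)).mul_left (outputDensity κ ρ z)
    rw [← ENNReal.ofReal_tsum_of_nonneg (fun m => hG0 m z) h.summable, h.tsum_eq, mul_one]
  have h2 : ∀ m, ∫⁻ z, ENNReal.ofReal (G m z) =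
      ENNReal.ofReal (⟪fock m, phaseConj κ 0 ρ (fock m)⟫_ℂ).re := by
    intro m
    rw [← ofReal_integral_eq_lintegral_ofReal (hGint m) (Eventually.of_forall (hG0 m)), hel,
      ← Complex.ofReal_re (∫ z, G m z), ← integral_complex_ofReal]
    congr 3
    ext z
    rw [← inner_conj_symm (coherent _) (fock m), Complex.mul_conj', inner_fock_left]
    simp only [hG]
    push_cast
    rfl
  have htr := hasSum_re_inner_phaseConj_zero κ hρ
  simp only [h1]
  rw [lintegral_tsum fun m => (hGint m).aestronglyMeasurable.aemeasurable.ennreal_ofReal]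
  simp only [h2]
  rw [← ENNReal.ofReal_tsum_of_nonneg _ htr.summable, htr.tsum_eq, ENNReal.ofReal_one]
  intro m
  rw [hel, integral_congr_ae (g := fun z => (G m z : ℂ)), integral_complex_ofReal,
    Complex.ofReal_re]
  · exact integral_nonneg (hG0 m)
  · refine Eventually.of_forall fun z => ?_
    beta_reduce
    rw [← inner_conj_symm (coherent _) (fock m), Complex.mul_conj', inner_fock_left]
    simp only [hG]
    push_cast
    rfl

theorem isClassical_phaseConj_zero {κ : ℝ} (hκ : 0 ≤ κ) {ρ : Mode →L[ℂ] Mode} (hρ : IsState ρ) :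
    IsClassical (phaseConj κ 0 ρ) := by
  rcases hκ.eq_or_lt with rfl | hκ
  · rw [phaseConj_zero_zero hρ, ← coherent_zero]
    exact isClassical_ketBra_coherent 0
  · set s := κ / Real.sqrt (1 + κ ^ 2) with hs
    have hg : Measurable fun z => ENNReal.ofReal (outputDensity κ ρ z) :=
      (continuous_outputDensity κ ρ).measurable.ennreal_ofReal
    have hm : Measurable fun z : ℂ => (s : ℂ) * z := by fun_prop
    set μ : Measure ℂ := volume.withDensity fun z => ENNReal.ofReal (outputDensity κ ρ z) with hμ
    have : IsProbabilityMeasure μ := by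
      constructor
      rw [hμ, withDensity_apply _ MeasurableSet.univ, Measure.restrict_univ,
        lintegral_outputDensity hκ hρ]
    have hprob : IsProbabilityMeasure (μ.map fun z => (s : ℂ) * z) :=
      Measure.isProbabilityMeasure_map hm.aemeasurable
    -- The weight is the pushforward of the density under `z ↦ sz`, since the coherent states
    -- prepared are `|sz⟩`.
    refine ⟨μ.map fun z => (s : ℂ) * z, hprob, ext_fock fun m m' => ?_⟩
    rw [inner_phaseConj_zero_eq_integral hκ hρ, inner_integral_ketBra_coherent, integral_map
      hm.aemeasurable, hμ, integral_withDensity_eq_integral_toReal_smul hg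
        (Eventually.of_forall fun z => ENNReal.ofReal_lt_top)]
    · congr 1
      ext z
      rw [ENNReal.toReal_ofReal (outputDensity_nonneg κ hρ.1 z), Complex.real_smul]
    · exact ((continuous_const.inner continuous_coherent).mul
        (continuous_coherent.inner continuous_const)).aestronglyMeasurable

theorem isState_ketBra_fock_zero : IsState (ketBra (fock 0) (fock 0)) := by
  refine ⟨InnerProductSpace.isPositive_rankOne_self _, ?_⟩
  convert hasSum_single 0 ?_ using 1
  · rw [inner_ketBra, inner_fock_fock, if_pos rfl, mul_one]
  · intro k hk
    rw [inner_ketBra, inner_fock_fock, if_neg hk, zero_mul]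

theorem isNonclassical_phaseConj_vacuum (κ : ℝ) {n : ℕ} (hn : 0 < n) :
    IsNonclassical (phaseConj κ n (ketBra (fock 0) (fock 0))) :=
  ⟨isState_phaseConj_vacuum κ n, fun h =>
    h.inner_fock_zero_ne_zero (inner_phaseConj_vacuum_of_lt κ hn)⟩

end Classical

end PhotonAdded

theorem mainTheorem3 (κ : ℝ) (hκ : 0 ≤ κ) (n : ℕ) :
    (PhotonAdded.IsNonclassicalityBreaking (PhotonAdded.phaseConj κ n) ↔ n = 0) ∧
    (0 < n →
      (∀ τ : ℕ, τ < n →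
        inner ℂ (PhotonAdded.fock τ)
          (PhotonAdded.phaseConj κ n
            (PhotonAdded.ketBra (PhotonAdded.fock 0) (PhotonAdded.fock 0))
            (PhotonAdded.fock τ)) = 0) ∧
      PhotonAdded.husimiQ
        (PhotonAdded.phaseConj κ n
          (PhotonAdded.ketBra (PhotonAdded.fock 0) (PhotonAdded.fock 0))) 0 = 0 ∧
      PhotonAdded.IsNonclassical
        (PhotonAdded.phaseConj κ n
          (PhotonAdded.ketBra (PhotonAdded.fock 0) (PhotonAdded.fock 0)))) := by
  refine ⟨⟨fun h => ?_, ?_⟩, fun hn => ⟨fun τ hτ => ?_, ?_, ?_⟩⟩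
  · by_contra hn
    exact (PhotonAdded.isNonclassical_phaseConj_vacuum κ (Nat.pos_of_ne_zero hn)).2
      (h _ PhotonAdded.isState_ketBra_fock_zero)
  · rintro rfl ρ hρ
    exact PhotonAdded.isClassical_phaseConj_zero hκ hρ
  · exact PhotonAdded.inner_phaseConj_vacuum_of_lt κ hτ
  · rw [PhotonAdded.husimiQ, PhotonAdded.coherent_zero]
    exact PhotonAdded.inner_phaseConj_vacuum_of_lt κ hn
  · exact PhotonAdded.isNonclassical_phaseConj_vacuum κ hn
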